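/- For $m\ge 1$ let $[m]_q=1+q+\cdots+q^{m-1}$. For $n\ge 1$ let $B_n$ be the set of words $\sigma=\sigma_1\sigma_2\cdots\sigma_n$ with $\sigma_i\in\{-n,\ldots,-1,1,\ldots,n\}$ such that $|\sigma_1|\cdots|\sigma_n|$ is a permutation of $\{1,\ldots,n\}$, and let $\operatorname{neg}(\sigma)=\#\{i:\sigma_i<0\}$. Let $D_n$ be the set of $\sigma\in B_n$ with $\operatorname{neg}(\sigma)$ even, and let $\mathcal D^D_n$ be the set of derangements in $D_n$, that is, of $\sigma\in D_n$ with $\sigma_i\ne i$ for all $1\le i\le n$. Order the integers in $[-n,n]$ by $-1\prec-2\prec\cdots\prec-n\prec0\prec1\prec2\prec\cdots\prec n$. For $\sigma\in B_n$ put $$\operatorname{maj}(\sigma)=\sum_{1\le i\le n-1,\ \sigma_i\succ\sigma_{i+1}} i,\qquad \operatorname{fmaj}(\sigma)=2\operatorname{maj}(\sigma)+\operatorname{neg}(\sigma),$$ and for $\sigma\in D_n$ define the D-major index of Biagioli and Caselli by $$\operatorname{Dmaj}(\sigma)=\operatorname{fmaj}(\sigma_1\cdots\sigma_{n-1}|\sigma_n|).$$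 **Theorem.** For every $n\ge 2$, as an identity of rational functions in $q$ over $\mathbb Q$, $$\sum_{\sigma\in\mathcal D^D_n}q^{\operatorname{Dmaj}(\sigma)}=[2]_q[4]_q\cdots[2n-2]_q\sum_{k=0}^{n-2}\frac{(-1)^kq^{2\binom k2}}{[2]_q[4]_q\cdots[2k]_q}\left(q^{2k+1}[n-1-k]_q+\frac12\left(1-\left(\frac{1-q}{1+q}\right)^{n-k-1}\right)\right),$$ where the empty product $[2]_q[4]_q\cdots[2k]_q$ for $k=0$ is $1$. -/

import Mathlib

open Polynomial

/-- The `q`-integer `[m]_q = 1 + q + ⋯ + q ^ (m - 1)`. -/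
def qInt {R : Type*} [Semiring R] (q : R) (m : ℕ) : R :=
  ∑ i ∈ Finset.range m, q ^ i

/-- The product `[2]_q [4]_q ⋯ [2m]_q`. -/
def qEvenFactorial {R : Type*} [CommSemiring R] (q : R) (m : ℕ) : R :=
  ∏ j ∈ Finset.Icc 1 m, qInt q (2 * j)

/-- The hyperoctahedral group `B_n` as a set of words: the words `w_1 ⋯ w_n` with letters in
`[-n, n]` such that `|w_1| ⋯ |w_n|` is a permutation of `[n]`. The position `i ∈ [n]` is
represented by the element of `Fin n` with value `i - 1`. -/
noncomputable def signedPerms (n : ℕ) : Finset (Fin n → ℤ) :=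
  (Fintype.piFinset fun _ : Fin n => Finset.Icc (-(n : ℤ)) (n : ℤ)).filter
    fun w => ∃ p : Equiv.Perm (Fin n), ∀ i, |w i| = ((p i : ℕ) : ℤ) + 1

/-- The number of negative letters of a word. -/
def negCount {n : ℕ} (w : Fin n → ℤ) : ℕ :=
  (Finset.univ.filter fun i => w i < 0).card

/-- The even-signed permutation group `D_n`, as a set of words. -/
noncomputable def evenSignedPerms (n : ℕ) : Finset (Fin n → ℤ) :=
  (signedPerms n).filter fun w => Even (negCount w)

/-- The derangements in `D_n`: the words in `D_n` with `w_i ≠ i` for all `i ∈ [n]`. -/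
noncomputable def derangementsD (n : ℕ) : Finset (Fin n → ℤ) :=
  (evenSignedPerms n).filter fun w => ∀ i : Fin n, w i ≠ ((i : ℕ) : ℤ) + 1

/-- The strict order `-1 ≺ -2 ≺ -3 ≺ ⋯ ≺ 0 ≺ 1 ≺ 2 ≺ ⋯` on the integers. -/
def Prec (a b : ℤ) : Prop :=
  (a < 0 ∧ b < 0 ∧ b < a) ∨ (a < 0 ∧ 0 ≤ b) ∨ (0 ≤ a ∧ 0 ≤ b ∧ a < b)

instance instDecidablePrec (a b : ℤ) : Decidable (Prec a b) := by
  unfold Prec; infer_instance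

/-- The descents of a word for the order `≺`: the positions that are not last and whose letter is
`≻` the next letter. -/
def desSet {n : ℕ} (w : Fin n → ℤ) : Finset (Fin n) :=
  Finset.univ.filter fun i => ∃ h : (i : ℕ) + 1 < n, Prec (w ⟨(i : ℕ) + 1, h⟩) (w i)

/-- The major index for the order `≺`: the sum of the descents, counted from `1`. -/
def majIndex {n : ℕ} (w : Fin n → ℤ) : ℕ :=
  ∑ i ∈ desSet w, ((i : ℕ) + 1)

/-- The flag major index. -/
def fmaj {n : ℕ} (w : Fin n → ℤ) : ℕ :=
  2 * majIndex w + negCount w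

/-- The word `|w|_n = w_1 ⋯ w_{n-1} |w_n|`. -/
def absLast {n : ℕ} (w : Fin n → ℤ) : Fin n → ℤ :=
  fun i => if (i : ℕ) + 1 = n then |w i| else w i

/-- The D-major index. -/
def Dmaj {n : ℕ} (w : Fin n → ℤ) : ℕ :=
  fmaj (absLast w)

/-- The Mahonian polynomial over the derangements in `D_n`. -/
noncomputable def dDPoly (n : ℕ) : ℚ[X] :=
  ∑ w ∈ derangementsD n, (X : ℚ[X]) ^ Dmaj w

/-! Making the last sign positive splits the sum. If `|σ_n| ≠ n`, the lost sign is recovered from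
the parity of the number of negative letters, so these words contribute the flag major index
enumerator of the derangements in `B_n` with positive last letter. If `|σ_n| = n`, then `σ_n = -n`;
deleting it leaves a derangement in `B_{n-1}` with an odd number of negative letters, and `Dmaj`
becomes its flag major index (`sum_derangementsD_pow_Dmaj`).

Both enumerators come from all signed permutations by stripping fixed points. Write `E_n = [2]_q ⋯
[2n]_q`. Once the last letter is prescribed, the flag major index has enumerator `E_{n-1}` times a
power of `q` (`sum_pow_flagMaj_append`). Inserting fixed points into a derangement in all possible
ways multiplies its weight by a `q²`-binomial coefficient, with a refinement according to whether
the last letter is fixed (`shuffleSum_formula`). Hence, with `e(t) = ∑ tⁿ/E_n`, the series `D` of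
all derangements and `P` of those with positive last letter (size `n + 1` at `tⁿ`), coefficients
divided by `E_n`, satisfy `D(t) e(t) = ∑ tⁿ` and `P(t) e(q²t) = ∑ q [n]_q tⁿ`. The inverse of `e` is
explicit (`qExp_mul_qExpInv`).

Since the flag major index has the parity of the number of negative letters, the odd part is half
the difference of the derangement enumerators at `q` and `-q`; the ratio `E_n(-q)/E_n(q)` produces
the powers of `(1-q)/(1+q)`. -/

/-- A signed permutation: a permutation together with a sign for each position, `true` standing
for a positive letter. -/
abbrev SignedPerm (n : ℕ) : Type := Equiv.Perm (Fin n) × (Fin n → Bool)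

/-! ### Signed permutations and appending a last letter -/

namespace SignedPerm

/-- The position of the `i`-th letter of `x` in the order `-1 ≺ -2 ≺ ⋯ ≺ -n ≺ 1 ≺ ⋯ ≺ n`. -/
def key {n : ℕ} (x : SignedPerm n) (i : ℕ) : ℕ :=
  if h : i < n then (x.1 ⟨i, h⟩ : ℕ) + (if x.2 ⟨i, h⟩ then n else 0) else 0

/-- The major index; a descent between the positions `i` and `i + 1` (counted from `1`) is recorded
at the index `i`, which is the position of its right letter counted from `0`. -/
def maj {n : ℕ} (x : SignedPerm n) : ℕ :=
  ∑ i ∈ Finset.range n, if key x i < key x (i - 1) then i else 0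

/-- The number of negative letters. -/
def neg {n : ℕ} (x : SignedPerm n) : ℕ :=
  ∑ i, if x.2 i then 0 else 1

/-- The flag major index. -/
def flagMaj {n : ℕ} (x : SignedPerm n) : ℕ :=
  2 * maj x + neg x

/-- The word obtained from `x` by appending the letter of absolute value `v + 1` and sign `b`, after
raising the letters of `x` of absolute value above `v`. -/
def append {n : ℕ} (x : SignedPerm n) (v : Fin (n + 1)) (b : Bool) : SignedPerm (n + 1) :=
  ((finSuccEquivLast.trans (Equiv.optionCongr x.1)).trans (finSuccEquiv' v).symm,
    Fin.snoc (α := fun _ => Bool) x.2 b)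

variable {n : ℕ} (x : SignedPerm n) (v : Fin (n + 1)) (b : Bool)

@[simp] lemma append_fst_castSucc (i : Fin n) :
    (x.append v b).1 i.castSucc = v.succAbove (x.1 i) := by
  simp [append]

@[simp] lemma append_fst_last : (x.append v b).1 (Fin.last n) = v := by
  simp [append]

@[simp] lemma append_snd_castSucc (i : Fin n) : (x.append v b).2 i.castSucc = x.2 i := by
  simp [append]

@[simp] lemma append_snd_last : (x.append v b).2 (Fin.last n) = b := by
  simp [append]

lemma append_bijective : Function.Bijective
    fun y : SignedPerm n × Fin (n + 1) × Bool => y.1.append y.2.1 y.2.2 := by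
  rw [Fintype.bijective_iff_injective_and_card]
  constructor
  · rintro ⟨x, v, b⟩ ⟨x', v', b'⟩ h
    simp only at h
    have hv : v = v' := by
      rw [← append_fst_last x v b, h, append_fst_last]
    have hb : b = b' := by
      rw [← append_snd_last x v b, h, append_snd_last]
    subst hv hb
    have h1 : x.1 = x'.1 := by
      ext i : 1
      apply Fin.succAbove_right_injective (p := v)
      rw [← append_fst_castSucc x v b, h, append_fst_castSucc]
    have h2 : x.2 = x'.2 := by
      ext i : 1
      rw [← append_snd_castSucc x v b, h, append_snd_castSucc]
    rw [Prod.ext h1 h2]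
  · simp [Fintype.card_perm, Nat.factorial_succ, pow_succ]
    ring

lemma sum_eq_sum_append {M : Type*} [AddCommMonoid M] (f : SignedPerm (n + 1) → M) :
    ∑ y, f y = ∑ v : Fin (n + 1), ∑ b : Bool, ∑ x : SignedPerm n, f (x.append v b) := by
  rw [← append_bijective.sum_comp, Fintype.sum_prod_type, Finset.sum_comm,
    Fintype.sum_prod_type]

lemma key_of_lt {i : ℕ} (h : i < n) :
    key x i = (x.1 ⟨i, h⟩ : ℕ) + (if x.2 ⟨i, h⟩ then n else 0) := by
  simp [key, h]

lemma key_append_of_lt {i : ℕ} (h : i < n) :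
    key (x.append v b) i = (v.succAbove (x.1 ⟨i, h⟩) : ℕ) + (if x.2 ⟨i, h⟩ then n + 1 else 0) := by
  rw [key_of_lt _ (by omega : i < n + 1)]
  have : (⟨i, by omega⟩ : Fin (n + 1)) = Fin.castSucc ⟨i, h⟩ := rfl
  rw [this, append_fst_castSucc, append_snd_castSucc]

lemma key_append_last : key (x.append v b) n = (v : ℕ) + (if b then n + 1 else 0) := by
  rw [key_of_lt _ (by omega : n < n + 1)]
  have : (⟨n, by omega⟩ : Fin (n + 1)) = Fin.last n := rfl
  rw [this, append_fst_last, append_snd_last]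

lemma key_append_lt_key_append {i j : ℕ} (hi : i < n) (hj : j < n) :
    key (x.append v b) i < key (x.append v b) j ↔ key x i < key x j := by
  rw [key_append_of_lt x v b hi, key_append_of_lt x v b hj, key_of_lt x hi, key_of_lt x hj]
  have h1 := (v.succAbove (x.1 ⟨i, hi⟩)).2
  have h2 := (v.succAbove (x.1 ⟨j, hj⟩)).2
  have h3 : (v.succAbove (x.1 ⟨i, hi⟩) : ℕ) < (v.succAbove (x.1 ⟨j, hj⟩) : ℕ) ↔
      (x.1 ⟨i, hi⟩ : ℕ) < (x.1 ⟨j, hj⟩ : ℕ) := by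
    rw [← Fin.lt_def, ← Fin.lt_def, Fin.succAbove_lt_succAbove_iff]
  have h4 := (x.1 ⟨i, hi⟩).2
  have h5 := (x.1 ⟨j, hj⟩).2
  split_ifs <;> omega

/-- Letters of absolute value above `v` are raised past the new one, so the strict comparison after
appending is a weak one before. -/
lemma key_append_last_lt {i : ℕ} (hi : i < n) :
    key (x.append v b) n < key (x.append v b) i ↔ (v : ℕ) + (if b then n else 0) ≤ key x i := by
  rw [key_append_of_lt x v b hi, key_append_last, key_of_lt x hi]
  have h1 := (v.succAbove (x.1 ⟨i, hi⟩)).2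
  have h3 : (v : ℕ) < (v.succAbove (x.1 ⟨i, hi⟩) : ℕ) ↔ (v : ℕ) ≤ (x.1 ⟨i, hi⟩ : ℕ) := by
    rw [← Fin.lt_def, Fin.lt_succAbove_iff_le_castSucc, Fin.le_def, Fin.val_castSucc]
  have h4 := (x.1 ⟨i, hi⟩).2
  have h5 := v.2
  split_ifs <;> omega

lemma neg_append : neg (x.append v b) = neg x + (if b then 0 else 1) := by
  simp [neg, Fin.sum_univ_castSucc]

lemma maj_append : maj (x.append v b) =
    maj x + (if (v : ℕ) + (if b then n else 0) ≤ key x (n - 1) then n else 0) := by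
  rw [maj, Finset.sum_range_succ, maj]
  congr 1
  · refine Finset.sum_congr rfl fun i hi => ?_
    rw [Finset.mem_range] at hi
    simp only [key_append_lt_key_append x v b hi (by omega : i - 1 < n)]
  · rcases Nat.eq_zero_or_pos n with rfl | hn
    · simp
    · simp only [key_append_last_lt x v b (by omega : n - 1 < n)]

lemma flagMaj_append : flagMaj (x.append v b) = flagMaj x +
    2 * (if (v : ℕ) + (if b then n else 0) ≤ key x (n - 1) then n else 0) +
      (if b then 0 else 1) := by
  rw [flagMaj, flagMaj, maj_append, neg_append]
  ring

lemma flagMaj_append_last : flagMaj (x.append (Fin.last n) true) = flagMaj x := by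
  rw [flagMaj_append]
  rcases Nat.eq_zero_or_pos n with rfl | hn
  · simp
  · have := (x.1 ⟨n - 1, by omega⟩).2
    rw [key_of_lt x (by omega : n - 1 < n), if_neg]
    · simp
    · simp only [Fin.val_last, if_true]
      split_ifs <;> omega

end SignedPerm

/-! ### Flag major index over all signed permutations -/

section totals

variable {R : Type*} [CommRing R] (q : R)

lemma qInt_add (a b : ℕ) : qInt q (a + b) = qInt q a + q ^ a * qInt q b := by
  simp [qInt, Finset.sum_range_add, Finset.mul_sum, pow_add]

lemma qEvenFactorial_zero : qEvenFactorial q 0 = 1 := by simp [qEvenFactorial]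

lemma qEvenFactorial_succ (m : ℕ) :
    qEvenFactorial q (m + 1) = qEvenFactorial q m * qInt q (2 * (m + 1)) := by
  simp [qEvenFactorial, Finset.prod_Icc_succ_top]

lemma sum_fin_bool_eq_sum_range {M : Type*} [AddCommMonoid M] (n : ℕ) (f : ℕ → M) :
    ∑ v : Fin n, ∑ b : Bool, f ((v : ℕ) + if b then n else 0) = ∑ i ∈ Finset.range (2 * n), f i := by
  rw [two_mul, Finset.sum_range_add, Finset.sum_comm, ← Fin.sum_univ_eq_sum_range,
    ← Fin.sum_univ_eq_sum_range (fun i => f (n + i))]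
  simp [add_comm]

/-- The exponents are a rotation of the `n` consecutive integers starting at `n - t`. -/
lemma sum_range_rotate (n t : ℕ) (ht : t ≤ n) :
    ∑ i ∈ Finset.range n, q ^ (n - 1 - i) * q ^ (if t ≤ i then n else 0) =
      q ^ (n - t) * qInt q n := by
  obtain ⟨s, rfl⟩ := Nat.exists_eq_add_of_le ht
  rw [Finset.sum_range_add, add_tsub_cancel_left, add_comm t s, qInt_add, mul_add, add_comm]
  have h1 : ∑ i ∈ Finset.range t, q ^ (s + t - 1 - i) * q ^ (if t ≤ i then s + t else 0) =
      q ^ s * qInt q t := by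
    rw [qInt, ← Finset.sum_range_reflect, Finset.mul_sum]
    refine Finset.sum_congr rfl fun i hi => ?_
    rw [Finset.mem_range] at hi
    rw [if_neg (by omega), pow_zero, mul_one, ← pow_add]
    congr 1; omega
  have h2 : ∑ i ∈ Finset.range s, q ^ (s + t - 1 - (t + i)) *
      q ^ (if t ≤ t + i then s + t else 0) = q ^ t * (q ^ s * qInt q s) := by
    rw [qInt, ← Finset.sum_range_reflect, Finset.mul_sum, Finset.mul_sum]
    refine Finset.sum_congr rfl fun i hi => ?_
    rw [Finset.mem_range] at hi
    rw [if_pos (by omega), ← pow_add, ← pow_add, ← pow_add]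
    congr 1; omega
  rw [h1, h2]
  have h3 : qInt q (s + t) = qInt q (t + s) := by rw [add_comm]
  rw [qInt_add, qInt_add] at h3
  linear_combination -(q ^ s) * h3

namespace SignedPerm

/-- Induction on the length: summing over the previous letter, a descent into the last one adds `2n`
to the flag major index for words `x` of length `n`, which is exactly the rotation of
`sum_range_rotate`. -/
lemma sum_pow_flagMaj_append (n : ℕ) (v : Fin (n + 1)) (b : Bool) :
    ∑ x : SignedPerm n, q ^ flagMaj (x.append v b) =
      qEvenFactorial q n * q ^ (2 * (n + 1) - 1 - (v + if b then n + 1 else 0)) := by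
  induction n generalizing b with
  | zero =>
    have hv : v = 0 := Fin.ext (by omega)
    subst hv
    simp only [flagMaj_append]
    cases b <;> simp [flagMaj, maj, neg, qEvenFactorial_zero]
  | succ n ih =>
    rw [sum_eq_sum_append]
    have h1 : ∀ (u : Fin (n + 1)) (c : Bool),
        ∑ x : SignedPerm n, q ^ flagMaj ((x.append u c).append v b) =
          (fun i => qEvenFactorial q n * q ^ (if b then 0 else 1) * (q ^ (2 * (n + 1) - 1 - i) *
            q ^ (if v + (if b then n + 1 else 0) ≤ i then 2 * (n + 1) else 0)))
            ((u : ℕ) + if c then n + 1 else 0) := by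
      intro u c
      simp only [flagMaj_append (append _ u c), pow_add, ← Finset.sum_mul, Nat.add_sub_cancel,
        key_append_last]
      rw [ih u c, mul_ite, mul_zero]
      ring
    simp only [h1]
    rw [sum_fin_bool_eq_sum_range (n + 1) fun i => qEvenFactorial q n * q ^ (if b then 0 else 1) *
      (q ^ (2 * (n + 1) - 1 - i) *
        q ^ (if v + (if b then n + 1 else 0) ≤ i then 2 * (n + 1) else 0)),
      ← Finset.mul_sum]
    have hv := v.2
    rw [sum_range_rotate q (2 * (n + 1)) _ (by split_ifs <;> omega), qEvenFactorial_succ]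
    -- The unit from a negative last letter offsets the enlargement of the alphabet.
    have h2 : 2 * (n + 1 + 1) - 1 - ((v : ℕ) + if b then n + 1 + 1 else 0) =
        (if b then 0 else 1) + (2 * (n + 1) - (v + if b then n + 1 else 0)) := by
      split_ifs <;> omega
    rw [h2, pow_add]
    ring

theorem sum_pow_flagMaj (n : ℕ) :
    ∑ x : SignedPerm n, q ^ flagMaj x = qEvenFactorial q n := by
  rcases n with _ | n
  · simp [flagMaj, maj, neg, qEvenFactorial_zero]
  · rw [sum_eq_sum_append]
    simp only [sum_pow_flagMaj_append]
    rw [sum_fin_bool_eq_sum_range (n + 1) fun i =>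
        qEvenFactorial q n * q ^ (2 * (n + 1) - 1 - i), ← Finset.mul_sum, Finset.sum_range_reflect,
      qEvenFactorial_succ, qInt]

theorem sum_pow_flagMaj_last_pos (n : ℕ) :
    ∑ y : SignedPerm (n + 1), (if y.2 (Fin.last n) ∧ y.1 (Fin.last n) ≠ Fin.last n then
      q ^ flagMaj y else 0) = qEvenFactorial q n * (q * qInt q n) := by
  rw [sum_eq_sum_append]
  simp only [append_fst_last, append_snd_last, Fintype.sum_bool, Fin.sum_univ_castSucc]
  simp only [Finset.sum_ite_irrel, sum_pow_flagMaj_append]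
  simp only [Fin.castSucc_ne_last, ne_eq, not_false_eq_true, and_self, if_true, not_true,
    and_false, if_false, Finset.sum_const_zero, add_zero, Bool.false_eq_true, false_and]
  rw [← Finset.mul_sum, qInt, ← Finset.sum_range_reflect, Finset.mul_sum (a := q),
    ← Fin.sum_univ_eq_sum_range (fun i => q * q ^ (n - 1 - i))]
  congr 1
  refine Finset.sum_congr rfl fun i _ => ?_
  have := i.2
  rw [← pow_succ']
  congr 1
  simp only [Fin.val_castSucc]
  omega

end SignedPerm

end totals

/-! ### The `q²`-binomial coefficients and their two Pascal rules -/

section binomial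

variable {K : Type*} [Field K] (q : K)

/-- The `q²`-binomial coefficient of `a + b` over `a`. -/
def evenBinom (a b : ℕ) : K :=
  qEvenFactorial q (a + b) / (qEvenFactorial q a * qEvenFactorial q b)

variable {q} (hq : ∀ m : ℕ, qInt q (2 * (m + 1)) ≠ 0)

include hq

lemma qEvenFactorial_ne_zero (m : ℕ) : qEvenFactorial q m ≠ 0 := by
  induction m with
  | zero => simp [qEvenFactorial_zero]
  | succ m ih => rw [qEvenFactorial_succ]; exact mul_ne_zero ih (hq m)

lemma evenBinom_zero_left (b : ℕ) : evenBinom q 0 b = 1 := by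
  simp [evenBinom, qEvenFactorial_zero, qEvenFactorial_ne_zero hq]

lemma evenBinom_zero_right (a : ℕ) : evenBinom q a 0 = 1 := by
  simp [evenBinom, qEvenFactorial_zero, qEvenFactorial_ne_zero hq]

lemma evenBinom_succ_succ (a b : ℕ) : evenBinom q (a + 1) (b + 1) =
    evenBinom q a (b + 1) + (q ^ 2) ^ (a + 1) * evenBinom q (a + 1) b := by
  have ha := qEvenFactorial_ne_zero hq a
  have hb := qEvenFactorial_ne_zero hq b
  have ha' := hq a
  have hb' := hq b
  have h : qInt q (2 * (a + 1 + b + 1)) =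
      qInt q (2 * (a + 1)) + (q ^ 2) ^ (a + 1) * qInt q (2 * (b + 1)) := by
    rw [← pow_mul, ← qInt_add]
    congr 1; ring
  simp only [evenBinom, show a + (b + 1) = a + b + 1 by ring, show a + 1 + b = a + b + 1 by ring,
    show a + 1 + (b + 1) = a + b + 1 + 1 by ring, qEvenFactorial_succ q (a + b + 1),
    qEvenFactorial_succ q a, qEvenFactorial_succ q b]
  rw [show a + b + 1 + 1 = a + 1 + b + 1 by ring, h]
  field_simp

omit hq in
lemma evenBinom_comm (a b : ℕ) : evenBinom q a b = evenBinom q b a := by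
  rw [evenBinom, evenBinom, add_comm, mul_comm]

lemma evenBinom_succ_succ' (a b : ℕ) : evenBinom q (a + 1) (b + 1) =
    (q ^ 2) ^ (b + 1) * evenBinom q a (b + 1) + evenBinom q (a + 1) b := by
  rw [evenBinom_comm, evenBinom_succ_succ hq, evenBinom_comm b, evenBinom_comm (b + 1) a, add_comm]

end binomial

/-! ### Inserting fixed points into a derangement -/

section shuffles

variable (des exc : ℕ → Prop) [DecidablePred des] [DecidablePred exc]

/-- The number of elements of `S` below `n`. -/
def rankIn (S : Finset ℕ) (n : ℕ) : ℕ := (S.filter (· < n)).card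

/-- The condition for a descent with right position `n` in a word that has fixed points at the
positions outside `S`, and that reduces to a derangement with descents `des` and excedances `exc`
when they are deleted. -/
def IsShuffleDescent (S : Finset ℕ) (n : ℕ) : Prop :=
  if n ∈ S then (if n - 1 ∈ S then des (rankIn S n) else ¬ exc (rankIn S n))
  else (n - 1 ∈ S ∧ exc (rankIn S n - 1))

instance (S : Finset ℕ) (n : ℕ) : Decidable (IsShuffleDescent des exc S n) := by
  unfold IsShuffleDescent; infer_instance

/-- The sum of the descents of a word as in `IsShuffleDescent`. -/
def shuffleMaj (n : ℕ) (S : Finset ℕ) : ℕ :=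
  ∑ i ∈ Finset.range n, if IsShuffleDescent des exc S i then i else 0

/-- The sum of the descents among the first `n` letters. -/
def descentSum (n : ℕ) : ℕ := ∑ i ∈ Finset.range n, if des i then i else 0

lemma descentSum_succ (n : ℕ) :
    descentSum des (n + 1) = descentSum des n + if des n then n else 0 := by
  rw [descentSum, Finset.sum_range_succ, descentSum]

lemma rankIn_insert {S : Finset ℕ} {n i : ℕ} (h : i ≤ n) :
    rankIn (insert n S) i = rankIn S i := by
  rw [rankIn, rankIn, Finset.filter_insert, if_neg (by omega)]

lemma rankIn_of_subset {S : Finset ℕ} {n : ℕ} (h : S ⊆ Finset.range n) :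
    rankIn S n = S.card := by
  rw [rankIn, Finset.filter_true_of_mem]
  intro i hi
  exact Finset.mem_range.1 (h hi)

lemma shuffleMaj_insert (n : ℕ) (S : Finset ℕ) :
    shuffleMaj des exc n (insert n S) = shuffleMaj des exc n S := by
  refine Finset.sum_congr rfl fun i hi => ?_
  rw [Finset.mem_range] at hi
  have h1 : i ∈ insert n S ↔ i ∈ S := by simp [hi.ne]
  have h2 : i - 1 ∈ insert n S ↔ i - 1 ∈ S := by
    simp [(show i - 1 ≠ n by omega)]
  simp only [IsShuffleDescent, h1, h2, rankIn_insert hi.le]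

variable {R : Type*} [CommRing R] (x : R)

/-- The sum of `x ^ shuffleMaj` over the shuffles whose last letter is not a fixed point. -/
def shuffleSumMem (n k : ℕ) : R :=
  ∑ S ∈ Finset.powersetCard k (Finset.range n),
    if n - 1 ∈ S then x ^ shuffleMaj des exc n S else 0

/-- The sum of `x ^ shuffleMaj` over the shuffles whose last letter is a fixed point. -/
def shuffleSumNotMem (n k : ℕ) : R :=
  ∑ S ∈ Finset.powersetCard k (Finset.range n),
    if n - 1 ∈ S then 0 else x ^ shuffleMaj des exc n S

lemma shuffleSumMem_add_shuffleSumNotMem (n k : ℕ) :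
    shuffleSumMem des exc x n k + shuffleSumNotMem des exc x n k =
      ∑ S ∈ Finset.powersetCard k (Finset.range n), x ^ shuffleMaj des exc n S := by
  rw [shuffleSumMem, shuffleSumNotMem, ← Finset.sum_add_distrib]
  refine Finset.sum_congr rfl fun S _ => ?_
  split_ifs <;> simp

lemma sum_powersetCard_range_succ {M : Type*} [AddCommMonoid M] (n k : ℕ) (f : Finset ℕ → M) :
    ∑ S ∈ Finset.powersetCard (k + 1) (Finset.range (n + 1)), f S =
      ∑ S ∈ Finset.powersetCard (k + 1) (Finset.range n), f S +
        ∑ S ∈ Finset.powersetCard k (Finset.range n), f (insert n S) := by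
  have hmem : ∀ k, ∀ S ∈ Finset.powersetCard k (Finset.range n), n ∉ S := by
    intro k S hS hn
    have := (Finset.mem_powersetCard.1 hS).1 hn
    simp at this
  rw [Finset.range_add_one, ← Nat.succ_eq_add_one,
    Finset.powersetCard_succ_insert Finset.notMem_range_self, Finset.sum_union, Finset.sum_image]
  · intro S hS T hT h
    rw [← Finset.erase_insert (hmem k S hS), h, Finset.erase_insert (hmem k T hT)]
  · rw [Finset.disjoint_left]
    intro S hS hS'
    obtain ⟨T, -, rfl⟩ := Finset.mem_image.1 hS'
    exact hmem _ _ hS (Finset.mem_insert_self _ _)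

lemma shuffleSumMem_zero_right (n : ℕ) : shuffleSumMem des exc x n 0 = 0 := by
  simp [shuffleSumMem]

lemma shuffleSumNotMem_zero_right (n : ℕ) : shuffleSumNotMem des exc x n 0 = 1 := by
  simp [shuffleSumNotMem, shuffleMaj, IsShuffleDescent]

lemma shuffleSumNotMem_self (n : ℕ) (hn : 0 < n) : shuffleSumNotMem des exc x n n = 0 := by
  have h := Finset.powersetCard_self (Finset.range n)
  rw [Finset.card_range] at h
  rw [shuffleSumNotMem, h, Finset.sum_singleton, if_pos]
  simp [hn]

/-- This recursion and the next remove the last position; whether it is a descent depends only on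
the kind of the letter before it and on `des`, `exc`. -/
lemma shuffleSumMem_succ_succ (n k : ℕ) :
    shuffleSumMem des exc x (n + 1) (k + 1) =
      shuffleSumMem des exc x n k * x ^ (if des k then n else 0) +
        shuffleSumNotMem des exc x n k * x ^ (if exc k then 0 else n) := by
  rw [shuffleSumMem, sum_powersetCard_range_succ, Finset.sum_eq_zero, zero_add, shuffleSumMem,
    shuffleSumNotMem, Finset.sum_mul, Finset.sum_mul, ← Finset.sum_add_distrib]
  · refine Finset.sum_congr rfl fun S hS => ?_
    obtain ⟨hS, hc⟩ := Finset.mem_powersetCard.1 hS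
    rw [if_pos (by simp), shuffleMaj, Finset.sum_range_succ, ← shuffleMaj, shuffleMaj_insert,
      pow_add]
    -- For `n = 0` the truncated `n - 1` is harmless: every exponent involved is `0`.
    rcases Nat.eq_zero_or_pos n with rfl | hn
    · split_ifs <;> simp
    · have h2 : n - 1 ∈ insert n S ↔ n - 1 ∈ S := by
        simp [(show n - 1 ≠ n by omega)]
      simp only [IsShuffleDescent, h2, rankIn_insert le_rfl, rankIn_of_subset hS, hc,
        Finset.mem_insert_self, if_true]
      by_cases h : n - 1 ∈ S
      · simp [h]
      · simp [h]
  · intro S hS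
    rw [if_neg]
    intro h
    have := (Finset.mem_powersetCard.1 hS).1 h
    simp at this

lemma shuffleSumNotMem_succ_succ (n k : ℕ) :
    shuffleSumNotMem des exc x (n + 1) (k + 1) =
      shuffleSumMem des exc x n (k + 1) * x ^ (if exc k then n else 0) +
        shuffleSumNotMem des exc x n (k + 1) := by
  rw [shuffleSumNotMem, sum_powersetCard_range_succ, add_comm, Finset.sum_eq_zero, zero_add,
    shuffleSumMem, shuffleSumNotMem, Finset.sum_mul, ← Finset.sum_add_distrib]
  · refine Finset.sum_congr rfl fun S hS => ?_
    obtain ⟨hS, hc⟩ := Finset.mem_powersetCard.1 hS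
    have hn : n ∉ S := fun h => by simpa using hS h
    rw [Nat.add_sub_cancel, if_neg hn, shuffleMaj, Finset.sum_range_succ, ← shuffleMaj, pow_add]
    simp only [IsShuffleDescent, hn, rankIn_of_subset hS, hc, if_false, Nat.add_sub_cancel]
    by_cases h : n - 1 ∈ S
    · simp [h]
    · simp [h]
  · intro S _
    rw [if_pos (by simp)]

end shuffles

section shuffleFormula

variable {des exc : ℕ → Prop} [DecidablePred des] [DecidablePred exc]
  {K : Type*} [Field K] {q : K}

/-- The two sums must be carried together, as each recursion uses both. The excedance status of the
last non-fixed letter decides which Pascal rule closes the induction. -/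
theorem shuffleSum_formula (hq : ∀ m : ℕ, qInt q (2 * (m + 1)) ≠ 0)
    (h1 : ∀ j, exc j → ¬ exc (j + 1) → des (j + 1))
    (h2 : ∀ j, ¬ exc j → exc (j + 1) → ¬ des (j + 1)) (n : ℕ) :
    (∀ a b, a + b = n → shuffleSumMem des exc (q ^ 2) (n + 1) (a + 1) =
        (q ^ 2) ^ descentSum des (a + 1) * (q ^ 2) ^ (if exc a then 0 else b) *
          evenBinom q a b) ∧
      (∀ a b, a + b = n → shuffleSumNotMem des exc (q ^ 2) (n + 1) a =
        (q ^ 2) ^ descentSum des a * (q ^ 2) ^ (if exc (a - 1) then a else 0) *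
          evenBinom q a b) := by
  generalize hx : q ^ 2 = x
  have hP := evenBinom_succ_succ hq
  have hP' := evenBinom_succ_succ' hq
  rw [hx] at hP hP'
  induction n with
  | zero =>
    constructor
    · rintro a b h
      obtain ⟨rfl, rfl⟩ : a = 0 ∧ b = 0 := by omega
      rw [shuffleSumMem_succ_succ, shuffleSumMem_zero_right, shuffleSumNotMem_zero_right]
      simp [evenBinom_zero_left hq, descentSum]
    · rintro a b h
      obtain ⟨rfl, rfl⟩ : a = 0 ∧ b = 0 := by omega
      rw [shuffleSumNotMem_zero_right]
      simp [evenBinom_zero_left hq, descentSum]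
  | succ n ih =>
    obtain ⟨ihA, ihB⟩ := ih
    constructor
    · rintro a b h
      rw [shuffleSumMem_succ_succ, descentSum_succ]
      rcases a with _ | a
      · rw [shuffleSumMem_zero_right, shuffleSumNotMem_zero_right, evenBinom_zero_left hq]
        obtain rfl : b = n + 1 := by omega
        simp [descentSum]
      · rw [ihA a b (by omega)]
        rcases b with _ | b
        · obtain rfl : a = n := by omega
          rw [shuffleSumNotMem_self _ _ _ _ (by omega), evenBinom_zero_right hq,
            evenBinom_zero_right hq, pow_add]
          simp
        · rw [ihB (a + 1) b (by omega), pow_add, Nat.add_sub_cancel]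
          have h1a := h1 a
          have h2a := h2 a
          have hn : n + 1 = (a + 1) + (b + 1) := by omega
          rw [hn]
          -- A change of excedance status forces `des (a + 1)`, so six of the eight cases survive.
          by_cases he : exc a <;> by_cases he' : exc (a + 1) <;> by_cases hd : des (a + 1)
          all_goals first
            | exact absurd (h1a he he') hd
            | exact absurd hd (h2a he he')
            | skip
          all_goals simp only [he, he', hd, if_true, if_false, pow_zero, mul_one, pow_add x (a + 1)]
          · rw [hP']; ring
          · rw [hP]; ring
          · rw [hP]; ring
          · rw [hP']; ring
          · rw [hP']; ring
          · rw [hP]; ring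
    · rintro a b h
      rcases a with _ | a
      · rw [shuffleSumNotMem_zero_right, evenBinom_zero_left hq]
        simp [descentSum]
      · rw [shuffleSumNotMem_succ_succ, ihA a b (by omega), Nat.add_sub_cancel]
        rcases b with _ | b
        · obtain rfl : a = n := by omega
          rw [shuffleSumNotMem_self _ _ _ _ (by omega), evenBinom_zero_right hq,
            evenBinom_zero_right hq]
          simp
        · rw [ihB (a + 1) b (by omega), Nat.add_sub_cancel]
          have hn : n + 1 = (a + 1) + (b + 1) := by omega
          rw [hn]
          by_cases he : exc a
          · simp only [he, if_true, pow_zero, mul_one, pow_add x (a + 1) (b + 1)]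
            rw [hP']; ring
          · simp only [he, if_false, pow_zero, mul_one]
            rw [hP']; ring

theorem sum_shuffles (hq : ∀ m : ℕ, qInt q (2 * (m + 1)) ≠ 0)
    (h1 : ∀ j, exc j → ¬ exc (j + 1) → des (j + 1))
    (h2 : ∀ j, ¬ exc j → exc (j + 1) → ¬ des (j + 1)) (a b : ℕ) :
    ∑ S ∈ Finset.powersetCard a (Finset.range (a + b)),
        (q ^ 2) ^ shuffleMaj des exc (a + b) S =
      (q ^ 2) ^ descentSum des a * evenBinom q a b := by
  rw [← shuffleSumMem_add_shuffleSumNotMem]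
  rcases a with _ | a
  · rw [shuffleSumMem_zero_right, shuffleSumNotMem_zero_right, evenBinom_zero_left hq]
    simp [descentSum]
  · have hA := (shuffleSum_formula hq h1 h2 (a + b)).1 a b rfl
    rw [show a + 1 + b = a + b + 1 by ring, hA]
    rcases b with _ | b
    · rw [add_zero, shuffleSumNotMem_self _ _ _ _ (by omega), evenBinom_zero_right hq,
        evenBinom_zero_right hq]
      simp
    · have hB := (shuffleSum_formula hq h1 h2 (a + (b + 1))).2 (a + 1) b (by ring)
      rw [hB, Nat.add_sub_cancel]
      by_cases he : exc a
      · simp only [he, if_true, pow_zero, mul_one]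
        rw [evenBinom_succ_succ hq]; ring
      · simp only [he, if_false, pow_zero, mul_one]
        rw [evenBinom_succ_succ' hq]; ring

theorem sum_shuffles_mem (hq : ∀ m : ℕ, qInt q (2 * (m + 1)) ≠ 0)
    (h1 : ∀ j, exc j → ¬ exc (j + 1) → des (j + 1))
    (h2 : ∀ j, ¬ exc j → exc (j + 1) → ¬ des (j + 1)) (a b : ℕ) (he : ¬ exc a) :
    ∑ S ∈ Finset.powersetCard (a + 1) (Finset.range (a + b + 1)),
        (if a + b ∈ S then (q ^ 2) ^ shuffleMaj des exc (a + b + 1) S else 0) =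
      (q ^ 2) ^ descentSum des (a + 1) * ((q ^ 2) ^ b * evenBinom q a b) := by
  have hA := (shuffleSum_formula hq h1 h2 (a + b)).1 a b rfl
  rw [if_neg he, mul_assoc] at hA
  exact hA

end shuffleFormula

/-! ### Reducing a signed permutation to its derangement -/

namespace SignedPerm

variable {n k : ℕ}

/-- The positions of `x` that are not fixed points. -/
def support (x : SignedPerm n) : Finset (Fin n) :=
  Finset.univ.filter fun i => ¬ (x.2 i = true ∧ x.1 i = i)

/-- The signed permutations without fixed points. -/
def derangements (n : ℕ) : Finset (SignedPerm n) :=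
  Finset.univ.filter fun x => ∀ i, ¬ (x.2 i = true ∧ x.1 i = i)

lemma mem_derangements {x : SignedPerm n} :
    x ∈ derangements n ↔ ∀ i, ¬ (x.2 i = true ∧ x.1 i = i) := by
  simp [derangements]

/-- The signed permutation that acts as `α` on the range of `e` and fixes all other positions. -/
noncomputable def extend (e : Fin k ↪o Fin n) (α : SignedPerm k) : SignedPerm n :=
  (α.1.viaFintypeEmbedding e.toEmbedding, Function.extend e α.2 fun _ => true)

section extend

variable (e : Fin k ↪o Fin n) (α : SignedPerm k)

@[simp] lemma extend_fst_apply (j : Fin k) : (extend e α).1 (e j) = e (α.1 j) :=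
  α.1.viaFintypeEmbedding_apply_image e.toEmbedding j

@[simp] lemma extend_snd_apply (j : Fin k) : (extend e α).2 (e j) = α.2 j :=
  e.injective.extend_apply α.2 (fun _ => true) j

lemma extend_fst_of_notMem {i : Fin n} (h : i ∉ Set.range e) : (extend e α).1 i = i :=
  α.1.viaFintypeEmbedding_apply_notMem_range e.toEmbedding h

lemma extend_snd_of_notMem {i : Fin n} (h : i ∉ Set.range e) : (extend e α).2 i = true :=
  Function.extend_apply' α.2 (fun _ => true) i h

lemma extend_injective : Function.Injective (extend e) := by
  intro α β h
  refine Prod.ext ?_ ?_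
  · ext j : 1
    apply e.injective
    rw [← extend_fst_apply, h, extend_fst_apply]
  · ext j : 1
    rw [← extend_snd_apply, h, extend_snd_apply]

lemma neg_extend : neg (extend e α) = neg α := by
  have h1 : neg α = ∑ i ∈ Finset.univ.map e.toEmbedding, if (extend e α).2 i then 0 else 1 := by
    simp [neg]
  rw [h1, neg]
  refine (Finset.sum_subset (Finset.subset_univ _) ?_).symm
  intro i _ hi
  rw [extend_snd_of_notMem, if_pos rfl]
  rintro ⟨j, rfl⟩
  exact hi (Finset.mem_map_of_mem _ (Finset.mem_univ _))

variable {e α}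

lemma support_extend (hα : α ∈ derangements k) :
    support (extend e α) = Finset.univ.map e.toEmbedding := by
  rw [mem_derangements] at hα
  ext i
  by_cases h : i ∈ Set.range e
  · obtain ⟨j, rfl⟩ := h
    have := hα j
    simpa [support] using this
  · have h' : ∀ j, e j ≠ i := fun j hj => h ⟨j, hj⟩
    simp [support, extend_fst_of_notMem e α h, extend_snd_of_notMem e α h, h']

end extend

/-- By injectivity no non-fixed position is sent to a fixed one, so the permutation restricts to the
support. -/
lemma exists_extend_eq (x : SignedPerm n) (e : Fin k ↪o Fin n)
    (he : Finset.univ.map e.toEmbedding = support x) :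
    ∃ α ∈ derangements k, extend e α = x := by
  have hmem : ∀ i, i ∈ Set.range e ↔ i ∈ support x := by
    intro i; rw [← he]; simp
  have hfix : ∀ i, i ∉ Set.range e → x.2 i = true ∧ x.1 i = i := by
    intro i hi
    rw [hmem] at hi
    simpa [support] using hi
  have hmap : ∀ j, x.1 (e j) ∈ Set.range e := by
    intro j
    by_contra h
    have h2 := x.1.injective (hfix _ h).2
    rw [h2] at h
    exact h ⟨j, rfl⟩
  choose p hp using hmap
  have hinj : Function.Injective p := by
    intro i j h
    apply e.injective
    apply x.1.injective
    rw [← hp, ← hp, h]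
  refine ⟨(Equiv.ofBijective p (Finite.injective_iff_bijective.1 hinj), fun j => x.2 (e j)), ?_, ?_⟩
  · rw [mem_derangements]
    rintro j ⟨h1, h2⟩
    have h3 := (hmem (e j)).1 ⟨j, rfl⟩
    simp only [support, Finset.mem_filter] at h3
    refine h3.2 ⟨h1, ?_⟩
    rw [← hp]
    exact congrArg e h2
  · refine Prod.ext ?_ ?_
    · ext i : 1
      by_cases h : i ∈ Set.range e
      · obtain ⟨j, rfl⟩ := h
        rw [extend_fst_apply]
        exact hp j
      · rw [extend_fst_of_notMem _ _ h, (hfix i h).2]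
    · ext i : 1
      by_cases h : i ∈ Set.range e
      · obtain ⟨j, rfl⟩ := h
        rw [extend_snd_apply]
      · rw [extend_snd_of_notMem _ _ h, (hfix i h).1]

lemma sum_support_eq {M : Type*} [AddCommMonoid M] (f : SignedPerm n → M) (S : Finset (Fin n)) :
    ∑ x with support x = S, f x =
      ∑ α ∈ derangements S.card, f (extend (S.orderEmbOfFin rfl) α) := by
  refine (Finset.sum_nbij (extend (S.orderEmbOfFin rfl)) ?_ (extend_injective _).injOn ?_
    fun _ _ => rfl).symm
  · intro α hα
    simp [support_extend hα]
  · intro x hx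
    have hx' : support x = S := by simpa using hx
    obtain ⟨α, hα, h⟩ := exists_extend_eq x (S.orderEmbOfFin rfl) (by simp [hx'])
    exact ⟨α, hα, h⟩

/-- Grouping by cardinality makes the size of the derangement independent of the support, so the two
sums can be exchanged. -/
lemma sum_finset_fin {M : Type*} [AddCommMonoid M] (F : ℕ → Finset ℕ → M) :
    ∑ S : Finset (Fin n), F S.card (S.map Fin.valEmbedding) =
      ∑ k ∈ Finset.range (n + 1), ∑ T ∈ Finset.powersetCard k (Finset.range n), F k T := by
  rw [← Finset.powerset_univ, Finset.sum_powerset, Finset.card_univ, Fintype.card_fin]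
  refine Finset.sum_congr rfl fun k _ => ?_
  have h : Finset.range n = Finset.univ.map (Fin.valEmbedding (n := n)) := by
    rw [Fin.map_valEmbedding_univ, Nat.Iio_eq_range]
  rw [h, Finset.powersetCard_map, Finset.sum_map]
  refine Finset.sum_congr rfl fun S hS => ?_
  rw [(Finset.mem_powersetCard.1 hS).2]
  rfl

lemma sum_eq_sum_extend {M : Type*} [AddCommMonoid M] (f : SignedPerm n → M)
    (F : (k : ℕ) → SignedPerm k → Finset ℕ → M)
    (h : ∀ (S : Finset (Fin n)), ∀ α ∈ derangements S.card,
      f (extend (S.orderEmbOfFin rfl) α) = F S.card α (S.map Fin.valEmbedding)) :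
    ∑ x, f x = ∑ k ∈ Finset.range (n + 1), ∑ α ∈ derangements k,
      ∑ T ∈ Finset.powersetCard k (Finset.range n), F k α T := by
  rw [← Finset.sum_fiberwise Finset.univ support f]
  simp only [sum_support_eq]
  have h1 : ∀ S : Finset (Fin n), ∑ α ∈ derangements S.card, f (extend (S.orderEmbOfFin rfl) α) =
      (fun k T => ∑ α ∈ derangements k, F k α T) S.card (S.map Fin.valEmbedding) :=
    fun S => Finset.sum_congr rfl (h S)
  simp only [h1]
  rw [sum_finset_fin fun k T => ∑ α ∈ derangements k, F k α T]
  exact Finset.sum_congr rfl fun k _ => Finset.sum_comm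

/-- The position `i` is a descent with right position `i`. -/
def IsDescent (x : SignedPerm n) (i : ℕ) : Prop := key x i < key x (i - 1)

/-- The `i`-th letter is positive and greater than its position. -/
def IsExcedance (x : SignedPerm n) (i : ℕ) : Prop := n + i < key x i

instance (x : SignedPerm n) : DecidablePred (IsDescent x) := fun _ => Nat.decLt _ _

instance (x : SignedPerm n) : DecidablePred (IsExcedance x) := fun _ => Nat.decLt _ _

lemma maj_eq_descentSum (x : SignedPerm n) : maj x = descentSum (IsDescent x) n := rfl

lemma not_isExcedance_of_le (x : SignedPerm n) {i : ℕ} (h : n ≤ i + 1) : ¬ IsExcedance x i := by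
  unfold IsExcedance key
  split_ifs with h1
  · have := (x.1 ⟨i, h1⟩).2
    omega
  · have := (x.1 ⟨i, h1⟩).2
    omega
  · omega

lemma key_ne_add (x : SignedPerm n) (hx : x ∈ derangements n) {i : ℕ} (hi : i < n) :
    key x i ≠ n + i := by
  have := mem_derangements.1 hx ⟨i, hi⟩
  rw [key_of_lt x hi]
  have h2 := (x.1 ⟨i, hi⟩).2
  split_ifs with h
  · simp only [h, true_and, Fin.ext_iff] at this
    omega
  · omega

/-- A fixed letter at position `i` would have key `n + i`. Here the left key exceeds `n + j`, while
the right one is at most `n + j`, the value `n + j + 1` being excluded in a derangement. -/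
lemma IsExcedance.isDescent {x : SignedPerm n} (hx : x ∈ derangements n) (j : ℕ)
    (h : IsExcedance x j) (h' : ¬ IsExcedance x (j + 1)) : IsDescent x (j + 1) := by
  by_cases hj : j + 1 < n
  · have := key_ne_add x hx hj
    unfold IsExcedance at h h'
    unfold IsDescent
    rw [Nat.add_sub_cancel]
    omega
  · exact absurd h (not_isExcedance_of_le x (by omega))

lemma IsExcedance.not_isDescent {x : SignedPerm n} (j : ℕ)
    (h : ¬ IsExcedance x j) (h' : IsExcedance x (j + 1)) : ¬ IsDescent x (j + 1) := by
  unfold IsExcedance at h h'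
  unfold IsDescent
  rw [Nat.add_sub_cancel]
  omega

section descents

variable (S : Finset (Fin n))

lemma mem_map_val_iff (h : S.card = k) (i : ℕ) :
    i ∈ S.map Fin.valEmbedding ↔ ∃ j, (S.orderEmbOfFin h j : ℕ) = i := by
  have h1 : ∀ l : Fin n, l ∈ S ↔ ∃ j, S.orderEmbOfFin h j = l := by
    intro l
    rw [← Set.mem_range, S.range_orderEmbOfFin h, Finset.mem_coe]
  simp only [Finset.mem_map, h1]
  constructor
  · rintro ⟨_, ⟨j, rfl⟩, rfl⟩
    exact ⟨j, rfl⟩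
  · rintro ⟨j, rfl⟩
    exact ⟨_, ⟨j, rfl⟩, rfl⟩

lemma rankIn_orderEmbOfFin (h : S.card = k) (j : Fin k) :
    rankIn (S.map Fin.valEmbedding) (S.orderEmbOfFin h j) = j := by
  have h1 : (S.map Fin.valEmbedding).filter (· < (S.orderEmbOfFin h j : ℕ)) =
      (Finset.Iio j).map ((S.orderEmbOfFin h).toEmbedding.trans Fin.valEmbedding) := by
    ext i
    rw [Finset.mem_filter, mem_map_val_iff S h]
    constructor
    · rintro ⟨⟨l, rfl⟩, hl⟩
      rw [← Fin.lt_def, (S.orderEmbOfFin h).lt_iff_lt] at hl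
      simp only [Finset.mem_map, Finset.mem_Iio]
      exact ⟨l, hl, rfl⟩
    · intro hi
      simp only [Finset.mem_map, Finset.mem_Iio] at hi
      obtain ⟨l, hl, rfl⟩ := hi
      refine ⟨⟨l, rfl⟩, ?_⟩
      change (S.orderEmbOfFin h l : ℕ) < _
      rwa [← Fin.lt_def, (S.orderEmbOfFin h).lt_iff_lt]
  rw [rankIn, h1, Finset.card_map, Fin.card_Iio]

lemma rankIn_succ {T : Finset ℕ} {i : ℕ} (h : i ∈ T) : rankIn T (i + 1) = rankIn T i + 1 := by
  have h1 : T.filter (· < i + 1) = insert i (T.filter (· < i)) := by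
    ext j
    simp only [Finset.mem_filter, Finset.mem_insert, Nat.lt_succ_iff_lt_or_eq]
    constructor
    · rintro ⟨h1, h2 | h2⟩
      · exact Or.inr ⟨h1, h2⟩
      · exact Or.inl h2
    · rintro (rfl | h2)
      · exact ⟨h, Or.inr rfl⟩
      · exact ⟨h2.1, Or.inl h2.2⟩
  rw [rankIn, h1, Finset.card_insert_of_notMem (by simp), rankIn]

variable {S} {α : SignedPerm k}

lemma key_extend_apply (e : Fin k ↪o Fin n) (j : Fin k) :
    key (extend e α) (e j) = (e (α.1 j) : ℕ) + if α.2 j then n else 0 := by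
  rw [key_of_lt _ (e j).2, Fin.eta, extend_fst_apply, extend_snd_apply]

lemma key_extend_of_notMem (h : S.card = k) {i : ℕ} (hi : i < n)
    (hS : i ∉ S.map Fin.valEmbedding) : key (extend (S.orderEmbOfFin h) α) i = i + n := by
  have h1 : (⟨i, hi⟩ : Fin n) ∉ Set.range (S.orderEmbOfFin h) := by
    rintro ⟨j, hj⟩
    exact hS ((mem_map_val_iff S h i).2 ⟨j, by rw [hj]⟩)
  rw [key_of_lt _ hi, extend_fst_of_notMem _ _ h1, extend_snd_of_notMem _ _ h1, if_pos rfl]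

lemma key_val (j : Fin k) : key α j = (α.1 j : ℕ) + if α.2 j then k else 0 :=
  key_of_lt α j.2

/-- The embedding preserves order, so neighbours in the support compare as in `α`. Against an
adjacent fixed point, a letter is larger exactly when it is an excedance, since its value is never
that fixed point. -/
lemma isDescent_extend_iff (h : S.card = k) (hα : α ∈ derangements k) {i : ℕ} (hi : i + 1 < n) :
    IsDescent (extend (S.orderEmbOfFin h) α) (i + 1) ↔
      IsShuffleDescent (IsDescent α) (IsExcedance α) (S.map Fin.valEmbedding) (i + 1) := by
  rw [mem_derangements] at hα
  have hlt : ∀ a b : Fin k, (S.orderEmbOfFin h a : ℕ) < S.orderEmbOfFin h b ↔ (a : ℕ) < b := by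
    intro a b
    rw [← Fin.lt_def, (S.orderEmbOfFin h).lt_iff_lt, Fin.lt_def]
  have hmem := mem_map_val_iff S h
  unfold IsDescent IsShuffleDescent IsExcedance
  beta_reduce
  rw [Nat.add_sub_cancel]
  by_cases h1 : i + 1 ∈ S.map Fin.valEmbedding <;> by_cases h0 : i ∈ S.map Fin.valEmbedding
  · rw [if_pos h1, if_pos h0]
    obtain ⟨l, hl⟩ := (hmem _).1 h1
    obtain ⟨j, hj⟩ := (hmem _).1 h0
    have hr := rankIn_orderEmbOfFin S h l
    have hr' := rankIn_orderEmbOfFin S h j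
    rw [hl] at hr
    rw [hj] at hr'
    have hjl : (j : ℕ) = l - 1 := by
      have := rankIn_succ h0
      omega
    rw [hr, ← hl, ← hj, ← hjl, key_extend_apply, key_extend_apply, key_val, key_val]
    have := hlt (α.1 l) (α.1 j)
    have := (S.orderEmbOfFin h (α.1 l)).2
    have := (S.orderEmbOfFin h (α.1 j)).2
    have := (α.1 l).2
    have := (α.1 j).2
    split_ifs <;> omega
  · rw [if_pos h1, if_neg h0, key_extend_of_notMem h (by omega) h0]
    obtain ⟨l, hl⟩ := (hmem _).1 h1
    have hr := rankIn_orderEmbOfFin S h l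
    rw [hl] at hr
    rw [hr, ← hl, key_extend_apply, key_val]
    have h2 : (S.orderEmbOfFin h (α.1 l) : ℕ) ≠ i := fun h' => h0 ((hmem _).2 ⟨_, h'⟩)
    have := hlt (α.1 l) l
    have := (S.orderEmbOfFin h (α.1 l)).2
    have := hα l
    rw [Fin.ext_iff] at this
    split_ifs with hs
    · have : (α.1 l : ℕ) ≠ l := fun h' => this ⟨hs, h'⟩
      omega
    · have := (α.1 l).2
      omega
  · rw [if_neg h1, key_extend_of_notMem h hi h1]
    obtain ⟨j, hj⟩ := (hmem _).1 h0
    have hr := rankIn_orderEmbOfFin S h j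
    rw [hj] at hr
    rw [rankIn_succ h0, hr, Nat.add_sub_cancel, ← hj, key_extend_apply, key_val]
    have h2 : (S.orderEmbOfFin h (α.1 j) : ℕ) ≠ i + 1 := fun h' => h1 ((hmem _).2 ⟨_, h'⟩)
    have := hlt j (α.1 j)
    have := (S.orderEmbOfFin h (α.1 j)).2
    rw [and_iff_right (by rwa [hj])]
    split_ifs with hs
    · omega
    · have := (α.1 j).2
      omega
  · rw [if_neg h1, key_extend_of_notMem h hi h1, key_extend_of_notMem h (by omega) h0]
    simp only [h0, false_and, iff_false]
    omega

lemma flagMaj_extend (h : S.card = k) (hα : α ∈ derangements k) :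
    flagMaj (extend (S.orderEmbOfFin h) α) =
      2 * shuffleMaj (IsDescent α) (IsExcedance α) n (S.map Fin.valEmbedding) + neg α := by
  rw [flagMaj, neg_extend, maj_eq_descentSum, descentSum, shuffleMaj]
  congr 2
  refine Finset.sum_congr rfl fun i hi => ?_
  rw [Finset.mem_range] at hi
  rcases i with _ | i
  · simp
  · simp only [isDescent_extend_iff h hα hi]

lemma orderEmbOfFin_eq_last {S : Finset (Fin (n + 1))} (h : S.card = k) (j : Fin k)
    (hj : S.orderEmbOfFin h j = Fin.last n) : (j : ℕ) = k - 1 := by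
  by_contra hne
  have hlt : (j : ℕ) + 1 < k := by have := j.2; omega
  have h1 : S.orderEmbOfFin h j < S.orderEmbOfFin h ⟨j + 1, hlt⟩ :=
    (S.orderEmbOfFin h).strictMono (by simp [Fin.lt_def])
  rw [hj] at h1
  exact absurd h1 (not_lt_of_ge (Fin.le_last _))

lemma extend_last_iff {S : Finset (Fin (n + 1))} (h : S.card = k) (hα : α ∈ derangements k) :
    ((extend (S.orderEmbOfFin h) α).2 (Fin.last n) = true ∧
      (extend (S.orderEmbOfFin h) α).1 (Fin.last n) ≠ Fin.last n) ↔
        (k ≤ key α (k - 1) ∧ n ∈ S.map Fin.valEmbedding) := by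
  by_cases hr : Fin.last n ∈ Set.range (S.orderEmbOfFin h)
  · obtain ⟨j, hj⟩ := hr
    have hjk := orderEmbOfFin_eq_last h j hj
    have h1 : n ∈ S.map Fin.valEmbedding := (mem_map_val_iff S h n).2 ⟨j, by rw [hj]; rfl⟩
    rw [and_iff_left h1, ← hj, extend_snd_apply, extend_fst_apply, ← hjk, key_val]
    have h2 := mem_derangements.1 hα j
    have h3 := (α.1 j).2
    rw [Ne, (S.orderEmbOfFin h).injective.eq_iff]
    split_ifs with hs
    · simp only [hs, true_and] at h2
      simp [hs, h2]
    · simp [hs]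
  · have h1 : n ∉ S.map Fin.valEmbedding := by
      rw [mem_map_val_iff S h]
      rintro ⟨j, hj⟩
      exact hr ⟨j, Fin.ext hj⟩
    simp [extend_fst_of_notMem _ _ hr, h1]

end descents

/-! ### Convolution identities for the derangement enumerators -/

section generatingFunctions

/-- The flag major index enumerator of the derangements. -/
def derangementSum {R : Type*} [CommRing R] (q : R) (n : ℕ) : R :=
  ∑ α ∈ derangements n, q ^ flagMaj α

/-- The flag major index enumerator of the derangements of size `n + 1` with positive last
letter. -/
def derangementSumLastPos {R : Type*} [CommRing R] (q : R) (n : ℕ) : R :=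
  ∑ α ∈ derangements (n + 1), if α.2 (Fin.last n) then q ^ flagMaj α else 0

variable {K : Type*} [Field K] {q : K} (hq : ∀ m : ℕ, qInt q (2 * (m + 1)) ≠ 0)

include hq

theorem qEvenFactorial_eq_sum (n : ℕ) :
    qEvenFactorial q n =
      ∑ k ∈ Finset.range (n + 1), evenBinom q k (n - k) * derangementSum q k := by
  rw [← sum_pow_flagMaj, sum_eq_sum_extend _ fun k α T =>
    q ^ neg α * (q ^ 2) ^ shuffleMaj (IsDescent α) (IsExcedance α) n T]
  · refine Finset.sum_congr rfl fun k hk => ?_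
    obtain ⟨b, rfl⟩ := Nat.exists_eq_add_of_le (Nat.lt_succ_iff.1 (Finset.mem_range.1 hk))
    rw [derangementSum, Finset.mul_sum]
    refine Finset.sum_congr rfl fun α hα => ?_
    rw [← Finset.mul_sum, sum_shuffles hq (fun j => IsExcedance.isDescent hα j)
      (fun j => IsExcedance.not_isDescent j), flagMaj, maj_eq_descentSum, add_tsub_cancel_left,
      pow_add, pow_mul]
    ring
  · intro S α hα
    rw [flagMaj_extend rfl hα, pow_add, pow_mul]
    ring

theorem qEvenFactorial_mul_qInt_eq_sum (n : ℕ) :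
    qEvenFactorial q n * (q * qInt q n) =
      ∑ k ∈ Finset.range (n + 1),
        (q ^ 2) ^ (n - k) * evenBinom q k (n - k) * derangementSumLastPos q k := by
  rw [← sum_pow_flagMaj_last_pos, sum_eq_sum_extend _ fun k α T =>
    if k ≤ key α (k - 1) then q ^ neg α * (if n ∈ T then
      (q ^ 2) ^ shuffleMaj (IsDescent α) (IsExcedance α) (n + 1) T else 0) else 0,
    Finset.sum_range_succ']
  · have h0 : ∑ α ∈ derangements 0, ∑ T ∈ Finset.powersetCard 0 (Finset.range (n + 1)),
        (if 0 ≤ key α (0 - 1) then q ^ neg α * (if n ∈ T then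
          (q ^ 2) ^ shuffleMaj (IsDescent α) (IsExcedance α) (n + 1) T else 0) else 0) = 0 := by
      simp
    rw [h0, add_zero]
    refine Finset.sum_congr rfl fun k hk => ?_
    obtain ⟨b, rfl⟩ := Nat.exists_eq_add_of_le (Nat.lt_succ_iff.1 (Finset.mem_range.1 hk))
    rw [derangementSumLastPos, Finset.mul_sum]
    refine Finset.sum_congr rfl fun α hα => ?_
    have hs : k + 1 ≤ key α (k + 1 - 1) ↔ α.2 (Fin.last k) = true := by
      rw [Nat.add_sub_cancel, key_of_lt α (Nat.lt_succ_self k)]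
      change _ ≤ (α.1 (Fin.last k) : ℕ) + (if α.2 (Fin.last k) then _ else _) ↔ _
      have := (α.1 (Fin.last k)).2
      split_ifs with h
      · simp [h]
      · exact iff_of_false (by omega) h
    simp only [hs]
    split_ifs with h
    · rw [← Finset.mul_sum, sum_shuffles_mem hq (fun j => IsExcedance.isDescent hα j)
        (fun j => IsExcedance.not_isDescent j) _ _ (not_isExcedance_of_le α le_rfl), flagMaj,
        maj_eq_descentSum, add_tsub_cancel_left, pow_add, pow_mul]
      ring
    · simp
  · intro S α hα
    simp only [extend_last_iff rfl hα, flagMaj_extend rfl hα, pow_add, pow_mul]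
    by_cases h1 : S.card ≤ key α (S.card - 1) <;>
      by_cases h2 : n ∈ S.map Fin.valEmbedding
    · rw [if_pos ⟨h1, h2⟩, if_pos h1, if_pos h2, mul_comm]
    · rw [if_neg (fun h => h2 h.2), if_pos h1, if_neg h2, mul_zero]
    · rw [if_neg (fun h => h1 h.1), if_neg h1]
    · rw [if_neg (fun h => h1 h.1), if_neg h1]

end generatingFunctions

end SignedPerm

/-! ### Inverting the `q`-exponential series -/

section inversion

variable {K : Type*} [Field K] {q : K}

lemma one_sub_mul_qInt {R : Type*} [CommRing R] (q : R) (m : ℕ) :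
    (1 - q) * qInt q m = 1 - q ^ m :=
  mul_neg_geom_sum q m

lemma qInt_ne_zero (h : ∀ m : ℕ, q ^ (2 * (m + 1)) ≠ 1) (m : ℕ) : qInt q (2 * (m + 1)) ≠ 0 := by
  intro h0
  have := one_sub_mul_qInt q (2 * (m + 1))
  rw [h0, mul_zero] at this
  exact h m (sub_eq_zero.1 this.symm).symm

variable (q) in
/-- The `q`-exponential series `∑ tⁿ / ([2]_q ⋯ [2n]_q)`. -/
noncomputable def qExp : PowerSeries K := PowerSeries.mk fun n => (qEvenFactorial q n)⁻¹

variable (q) in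
/-- The inverse of the series `qExp`. -/
noncomputable def qExpInv : PowerSeries K :=
  PowerSeries.mk fun n => (-1) ^ n * q ^ (2 * n.choose 2) / qEvenFactorial q n

variable (h : ∀ m : ℕ, q ^ (2 * (m + 1)) ≠ 1)

include h

lemma qExp_sub_rescale : qExp q - PowerSeries.rescale (q ^ 2) (qExp q) =
    PowerSeries.X * (PowerSeries.C (1 - q) * qExp q) := by
  have hq := qInt_ne_zero h
  ext n
  rcases n with _ | n
  · rw [map_sub, PowerSeries.coeff_rescale]; simp
  · rw [PowerSeries.coeff_succ_X_mul, PowerSeries.coeff_C_mul, map_sub, PowerSeries.coeff_rescale,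
      qExp, PowerSeries.coeff_mk, PowerSeries.coeff_mk, qEvenFactorial_succ]
    have h1 := qEvenFactorial_ne_zero hq n
    have h2 := one_sub_mul_qInt q (2 * (n + 1))
    have h3 := hq n
    rw [← pow_mul]
    field_simp
    linear_combination -h2

lemma qExpInv_sub_rescale : qExpInv q - PowerSeries.rescale (q ^ 2) (qExpInv q) =
    -(PowerSeries.X * (PowerSeries.C (1 - q) * PowerSeries.rescale (q ^ 2) (qExpInv q))) := by
  have hq := qInt_ne_zero h
  ext n
  rcases n with _ | n
  · rw [map_sub, PowerSeries.coeff_rescale]; simp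
  · rw [map_neg, PowerSeries.coeff_succ_X_mul, PowerSeries.coeff_C_mul, map_sub,
      PowerSeries.coeff_rescale, PowerSeries.coeff_rescale,
      qExpInv, PowerSeries.coeff_mk, PowerSeries.coeff_mk, qEvenFactorial_succ,
      Nat.choose_succ_succ' n 1, Nat.choose_one_right, mul_add, pow_add]
    have h1 := qEvenFactorial_ne_zero hq n
    have h2 := one_sub_mul_qInt q (2 * (n + 1))
    have h3 := hq n
    rw [← pow_mul, ← pow_mul]
    field_simp
    linear_combination q ^ (2 * n) * q ^ (2 * n.choose (1 + 1)) * h2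

/-- The two `q`-difference equations make the product invariant under `t ↦ q² t`; as no `q ^ (2m)`
with `m > 0` is `1`, it is constant. -/
theorem qExp_mul_qExpInv : qExp q * qExpInv q = 1 := by
  have hf := qExp_sub_rescale h
  have hg := qExpInv_sub_rescale h
  have hr : PowerSeries.rescale (q ^ 2) (qExp q * qExpInv q) = qExp q * qExpInv q := by
    rw [map_mul]
    linear_combination -PowerSeries.rescale (q ^ 2) (qExpInv q) * hf - qExp q * hg
  ext n
  rcases n with _ | n
  · simp [qExp, qExpInv, qEvenFactorial_zero]
  · have hc := congrArg (PowerSeries.coeff (n + 1)) hr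
    rw [PowerSeries.coeff_rescale, ← pow_mul] at hc
    rw [PowerSeries.coeff_one, if_neg (Nat.succ_ne_zero n)]
    have h3 : (q ^ (2 * (n + 1)) - 1) * PowerSeries.coeff (n + 1) (qExp q * qExpInv q) = 0 := by
      linear_combination hc
    exact (mul_eq_zero.1 h3).resolve_left (sub_ne_zero.2 (h n))

namespace SignedPerm

theorem derangementSum_eq (n : ℕ) : derangementSum q n = qEvenFactorial q n *
    ∑ k ∈ Finset.range (n + 1), (-1) ^ k * q ^ (2 * k.choose 2) / qEvenFactorial q k := by
  have hq := qInt_ne_zero h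
  have hE := qEvenFactorial_ne_zero hq
  have h1 : (PowerSeries.mk fun k => derangementSum q k / qEvenFactorial q k) * qExp q =
      PowerSeries.mk fun _ => 1 := by
    ext m
    rw [PowerSeries.coeff_mul, PowerSeries.coeff_mk]
    simp only [qExp, PowerSeries.coeff_mk]
    rw [Finset.Nat.sum_antidiagonal_eq_sum_range_succ
      (fun i j => derangementSum q i / qEvenFactorial q i * (qEvenFactorial q j)⁻¹),
      ← mul_right_inj' (hE m), mul_one]
    conv_rhs => rw [qEvenFactorial_eq_sum hq]
    rw [Finset.mul_sum]
    refine Finset.sum_congr rfl fun k hk => ?_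
    obtain ⟨b, rfl⟩ := Nat.exists_eq_add_of_le (Nat.lt_succ_iff.1 (Finset.mem_range.1 hk))
    rw [add_tsub_cancel_left, evenBinom]
    have := hE (k + b)
    field_simp
  have h2 : (PowerSeries.mk fun k => derangementSum q k / qEvenFactorial q k) =
      qExpInv q * PowerSeries.mk fun _ => 1 := by
    linear_combination qExpInv q * h1 -
      (PowerSeries.mk fun k => derangementSum q k / qEvenFactorial q k) * qExp_mul_qExpInv h
  have h3 := congrArg (PowerSeries.coeff n) h2
  rw [PowerSeries.coeff_mul, PowerSeries.coeff_mk] at h3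
  simp only [qExpInv, PowerSeries.coeff_mk, mul_one] at h3
  rw [Finset.Nat.sum_antidiagonal_eq_sum_range_succ
    (fun i _ => (-1) ^ i * q ^ (2 * i.choose 2) / qEvenFactorial q i)] at h3
  rw [← h3, mul_div_cancel₀ _ (hE n)]

theorem derangementSumLastPos_eq (n : ℕ) : derangementSumLastPos q n = qEvenFactorial q n *
    ∑ k ∈ Finset.range (n + 1), (-1) ^ k * q ^ (2 * k.choose 2) / qEvenFactorial q k *
      (q ^ (2 * k + 1) * qInt q (n - k)) := by
  have hq := qInt_ne_zero h
  have hE := qEvenFactorial_ne_zero hq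
  have h0 : PowerSeries.rescale (q ^ 2) (qExp q) * PowerSeries.rescale (q ^ 2) (qExpInv q) = 1 := by
    rw [← map_mul, qExp_mul_qExpInv h, map_one]
  have h1 : (PowerSeries.mk fun k => derangementSumLastPos q k / qEvenFactorial q k) *
      PowerSeries.rescale (q ^ 2) (qExp q) = PowerSeries.mk fun m => q * qInt q m := by
    ext m
    rw [PowerSeries.coeff_mul, PowerSeries.coeff_mk]
    simp only [qExp, PowerSeries.coeff_mk, PowerSeries.coeff_rescale]
    rw [Finset.Nat.sum_antidiagonal_eq_sum_range_succ
      (fun i j => derangementSumLastPos q i / qEvenFactorial q i *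
        ((q ^ 2) ^ j * (qEvenFactorial q j)⁻¹)),
      ← mul_div_cancel_left₀ (q * qInt q m) (hE m), qEvenFactorial_mul_qInt_eq_sum hq,
      Finset.sum_div]
    refine Finset.sum_congr rfl fun k hk => ?_
    obtain ⟨b, rfl⟩ := Nat.exists_eq_add_of_le (Nat.lt_succ_iff.1 (Finset.mem_range.1 hk))
    rw [add_tsub_cancel_left, evenBinom]
    have := hE (k + b)
    field_simp
  have h2 : (PowerSeries.mk fun k => derangementSumLastPos q k / qEvenFactorial q k) =
      PowerSeries.rescale (q ^ 2) (qExpInv q) * PowerSeries.mk fun m => q * qInt q m := by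
    linear_combination PowerSeries.rescale (q ^ 2) (qExpInv q) * h1 -
      (PowerSeries.mk fun k => derangementSumLastPos q k / qEvenFactorial q k) * h0
  have h3 := congrArg (PowerSeries.coeff n) h2
  rw [PowerSeries.coeff_mul, PowerSeries.coeff_mk] at h3
  simp only [qExpInv, PowerSeries.coeff_mk, PowerSeries.coeff_rescale] at h3
  rw [Finset.Nat.sum_antidiagonal_eq_sum_range_succ
    (fun i j => (q ^ 2) ^ i * ((-1) ^ i * q ^ (2 * i.choose 2) / qEvenFactorial q i) *
      (q * qInt q j))] at h3
  rw [← mul_div_cancel₀ (derangementSumLastPos q n) (hE n), h3]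
  congr 1
  refine Finset.sum_congr rfl fun k _ => ?_
  rw [← pow_mul, pow_succ q (2 * k)]
  ring

end SignedPerm

end inversion

/-! ### Derangements with an odd number of negative letters -/

section oddPart

open SignedPerm

/-- The flag major index enumerator of the derangements with an odd number of negative letters. -/
def oddDerangementSum {R : Type*} [CommRing R] (q : R) (n : ℕ) : R :=
  ∑ α ∈ derangements n, if Odd (neg α) then q ^ flagMaj α else 0

lemma two_mul_oddDerangementSum {R : Type*} [CommRing R] (q : R) (n : ℕ) :
    2 * oddDerangementSum q n = derangementSum q n - derangementSum (-q) n := by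
  rw [oddDerangementSum, derangementSum, derangementSum, Finset.mul_sum,
    ← Finset.sum_sub_distrib]
  refine Finset.sum_congr rfl fun α _ => ?_
  have h : Odd (flagMaj α) ↔ Odd (neg α) := by
    rw [flagMaj, add_comm, Nat.odd_add, iff_true_right (even_two_mul _)]
  split_ifs with ho
  · rw [(h.2 ho).neg_pow]; ring
  · rw [(Nat.not_odd_iff_even.1 (h.not.2 ho)).neg_pow]; ring

lemma qEvenFactorial_neg {K : Type*} [Field K] {q : K} (hq : 1 + q ≠ 0) (n : ℕ) :
    qEvenFactorial (-q) n = qEvenFactorial q n * ((1 - q) / (1 + q)) ^ n := by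
  induction n with
  | zero => simp [qEvenFactorial_zero]
  | succ n ih =>
    have h1 := one_sub_mul_qInt q (2 * (n + 1))
    have h2 := one_sub_mul_qInt (-q) (2 * (n + 1))
    rw [(even_two_mul (n + 1)).neg_pow, ← h1, sub_neg_eq_add] at h2
    have h3 : qInt (-q) (2 * (n + 1)) = qInt q (2 * (n + 1)) * ((1 - q) / (1 + q)) := by
      field_simp
      linear_combination h2
    rw [qEvenFactorial_succ, qEvenFactorial_succ, ih, h3, pow_succ]
    ring

theorem oddDerangementSum_eq {K : Type*} [Field K] [NeZero (2 : K)] {q : K}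
    (h : ∀ m : ℕ, q ^ (2 * (m + 1)) ≠ 1) (n : ℕ) :
    oddDerangementSum q n = qEvenFactorial q n *
      ∑ k ∈ Finset.range (n + 1), (-1) ^ k * q ^ (2 * k.choose 2) / qEvenFactorial q k *
        (1 / 2 * (1 - ((1 - q) / (1 + q)) ^ (n - k))) := by
  have h2 : (2 : K) ≠ 0 := NeZero.ne 2
  have hneg : ∀ m : ℕ, (-q) ^ (2 * (m + 1)) ≠ 1 := fun m => by
    rw [(even_two_mul (m + 1)).neg_pow]; exact h m
  have hE := qEvenFactorial_ne_zero (qInt_ne_zero h)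
  have hp : 1 + q ≠ 0 := fun h0 => h 0 (by linear_combination (q - 1) * h0)
  have hm : 1 - q ≠ 0 := fun h0 => h 0 (by linear_combination (-1 - q) * h0)
  have hr : (1 - q) / (1 + q) ≠ 0 := div_ne_zero hm hp
  have h3 := two_mul_oddDerangementSum q n
  rw [derangementSum_eq h, derangementSum_eq hneg, qEvenFactorial_neg hp, mul_assoc, ← mul_sub,
    Finset.mul_sum, ← Finset.sum_sub_distrib] at h3
  apply mul_left_cancel₀ h2
  rw [h3, mul_left_comm]
  congr 1
  rw [Finset.mul_sum]
  refine Finset.sum_congr rfl fun k hk => ?_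
  obtain ⟨b, rfl⟩ := Nat.exists_eq_add_of_le (Nat.lt_succ_iff.1 (Finset.mem_range.1 hk))
  rw [qEvenFactorial_neg hp, add_tsub_cancel_left, (even_two_mul (k.choose 2)).neg_pow]
  generalize (1 - q) / (1 + q) = r at hr
  have := hE k
  rw [pow_add]
  field_simp

end oddPart

/-! ### From signed permutations to words and `Dmaj` -/

namespace SignedPerm

variable {n : ℕ}

/-- The word of a signed permutation. -/
def word (x : SignedPerm n) (i : Fin n) : ℤ :=
  if x.2 i then ((x.1 i : ℕ) : ℤ) + 1 else -(((x.1 i : ℕ) : ℤ) + 1)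

lemma word_injective : Function.Injective (word (n := n)) := by
  intro x y h
  have h' : ∀ i, x.1 i = y.1 i ∧ x.2 i = y.2 i := by
    intro i
    have hi := congrFun h i
    unfold word at hi
    rw [Fin.ext_iff]
    split_ifs at hi with h1 h2 h2
    · exact ⟨by omega, by rw [h1, h2]⟩
    · omega
    · omega
    · exact ⟨by omega, by rw [Bool.eq_false_of_not_eq_true h1, Bool.eq_false_of_not_eq_true h2]⟩
  exact Prod.ext (Equiv.ext fun i => (h' i).1) (funext fun i => (h' i).2)

lemma abs_word (x : SignedPerm n) (i : Fin n) : |word x i| = ((x.1 i : ℕ) : ℤ) + 1 := by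
  unfold word
  split_ifs
  · exact abs_of_nonneg (by omega)
  · rw [abs_neg]; exact abs_of_nonneg (by omega)

lemma word_mem_signedPerms (x : SignedPerm n) : word x ∈ signedPerms n := by
  rw [signedPerms, Finset.mem_filter, Fintype.mem_piFinset]
  refine ⟨fun i => ?_, x.1, abs_word x⟩
  have h := (x.1 i).2
  rw [Finset.mem_Icc, ← abs_le, abs_word]
  omega

lemma exists_word_eq {w : Fin n → ℤ} (hw : w ∈ signedPerms n) : ∃ x : SignedPerm n, word x = w := by
  obtain ⟨-, p, hp⟩ := Finset.mem_filter.1 hw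
  refine ⟨(p, fun i => decide (0 < w i)), funext fun i => ?_⟩
  have := hp i
  simp only [word, decide_eq_true_eq]
  split_ifs with h
  · rw [abs_of_pos h] at this; exact this.symm
  · rw [abs_of_nonpos (not_lt.1 h)] at this; omega

lemma word_neg_iff (x : SignedPerm n) (i : Fin n) : word x i < 0 ↔ ¬ x.2 i = true := by
  unfold word
  split_ifs with h
  · simp only [h, not_true, iff_false]; omega
  · exact iff_of_true (by omega) h

lemma negCount_word (x : SignedPerm n) : negCount (word x) = neg x := by
  rw [negCount, neg, Finset.card_filter]
  refine Finset.sum_congr rfl fun i _ => ?_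
  simp only [word_neg_iff]
  split_ifs <;> rfl

lemma word_eq_iff (x : SignedPerm n) (i : Fin n) :
    word x i = ((i : ℕ) : ℤ) + 1 ↔ x.2 i = true ∧ x.1 i = i := by
  unfold word
  rw [Fin.ext_iff]
  split_ifs with h
  · simp only [h, true_and]; omega
  · exact iff_of_false (by omega) fun h' => h h'.1

lemma prec_word_iff (x : SignedPerm n) (i j : Fin n) :
    Prec (word x i) (word x j) ↔ key x i < key x j := by
  rw [key_val, key_val]
  have h1 := (x.1 i).2
  have h2 := (x.1 j).2
  unfold Prec word
  split_ifs <;> omega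

lemma majIndex_word (x : SignedPerm (n + 1)) : majIndex (word x) = maj x := by
  -- `desSet` indexes a descent by its left position and `maj` by its right one; the last position
  -- of the former and index `0` of the latter contribute nothing.
  rw [majIndex, desSet, Finset.sum_filter, Fin.sum_univ_castSucc, maj, Finset.sum_range_succ',
    ← Fin.sum_univ_eq_sum_range fun i =>
      if key x (i + 1) < key x (i + 1 - 1) then i + 1 else 0]
  congr 1
  · refine Finset.sum_congr rfl fun i _ => ?_
    have h : (∃ h : (i.castSucc : ℕ) + 1 < n + 1,
        Prec (word x ⟨(i.castSucc : ℕ) + 1, h⟩) (word x i.castSucc)) ↔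
          key x (i + 1) < key x (i + 1 - 1) := by
      simp only [prec_word_iff, Nat.add_sub_cancel, Fin.val_castSucc]
      exact ⟨fun h => h.2, fun h => ⟨by have := i.2; omega, h⟩⟩
    simp only [h]
    rfl
  · simp

lemma fmaj_word (x : SignedPerm (n + 1)) : fmaj (word x) = flagMaj x := by
  rw [fmaj, majIndex_word, negCount_word, flagMaj]

lemma absLast_word_append (x : SignedPerm n) (v : Fin (n + 1)) (b : Bool) :
    absLast (word (x.append v b)) = word (x.append v true) := by
  funext i
  rw [absLast]
  induction i using Fin.lastCases with
  | last => rw [Fin.val_last, if_pos rfl, abs_word]; simp [word]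
  | cast i =>
    have := i.2
    rw [Fin.val_castSucc, if_neg (by omega)]
    simp [word]

lemma Dmaj_word_append (x : SignedPerm n) (v : Fin (n + 1)) (b : Bool) :
    Dmaj (word (x.append v b)) = flagMaj (x.append v true) := by
  rw [Dmaj, absLast_word_append, fmaj_word]

lemma sum_derangementsD {M : Type*} [AddCommMonoid M] (f : (Fin n → ℤ) → M) :
    ∑ w ∈ derangementsD n, f w =
      ∑ x ∈ derangements n, if Even (neg x) then f (word x) else 0 := by
  rw [← Finset.sum_filter]
  refine (Finset.sum_nbij word ?_ word_injective.injOn ?_ fun _ _ => rfl).symm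
  · intro x hx
    obtain ⟨hx, he⟩ := Finset.mem_filter.1 hx
    rw [derangementsD, evenSignedPerms, Finset.mem_filter, Finset.mem_filter, negCount_word]
    refine ⟨⟨word_mem_signedPerms x, he⟩, fun i => ?_⟩
    rw [Ne, word_eq_iff]
    exact mem_derangements.1 hx i
  · intro w hw
    rw [Finset.mem_coe, derangementsD, evenSignedPerms, Finset.mem_filter, Finset.mem_filter] at hw
    obtain ⟨⟨hw, he⟩, hd⟩ := hw
    obtain ⟨x, rfl⟩ := exists_word_eq hw
    refine ⟨x, ?_, rfl⟩
    rw [negCount_word] at he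
    rw [Finset.mem_coe, Finset.mem_filter, mem_derangements]
    exact ⟨fun i => (word_eq_iff x i).not.1 (hd i), he⟩

lemma append_mem_derangements_iff (x : SignedPerm n) (v : Fin (n + 1)) (b : Bool) :
    x.append v b ∈ derangements (n + 1) ↔
      (∀ i, ¬ (x.2 i = true ∧ v.succAbove (x.1 i) = i.castSucc)) ∧
        ¬ (b = true ∧ v = Fin.last n) := by
  simp only [mem_derangements, Fin.forall_fin_succ', append_fst_castSucc, append_snd_castSucc,
    append_fst_last, append_snd_last]

lemma append_last_mem_derangements_iff (x : SignedPerm n) (b : Bool) :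
    x.append (Fin.last n) b ∈ derangements (n + 1) ↔ x ∈ derangements n ∧ b = false := by
  rw [append_mem_derangements_iff, mem_derangements]
  simp [Fin.succAbove_last]

theorem sum_derangementsD_pow_Dmaj {R : Type*} [CommRing R] (q : R) (n : ℕ) :
    ∑ w ∈ derangementsD (n + 1), q ^ Dmaj w =
      derangementSumLastPos q n + oddDerangementSum q n := by
  have hd : ∀ {m : ℕ} (f : SignedPerm m → R), ∑ x ∈ derangements m, f x =
      ∑ x, if x ∈ derangements m then f x else 0 := by
    intro m f
    rw [Finset.sum_ite_mem, Finset.univ_inter]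
  rw [sum_derangementsD, derangementSumLastPos, oddDerangementSum, hd, hd, hd,
    sum_eq_sum_append, sum_eq_sum_append, Fin.sum_univ_castSucc, Fin.sum_univ_castSucc]
  simp only [append_last_mem_derangements_iff, Fintype.sum_bool, append_snd_last, Dmaj_word_append,
    neg_append]
  rw [add_assoc]
  congr 1
  -- Last absolute value below `n + 1`: neither sign creates a fixed point there, and parity selects
  -- exactly one.
  · refine Finset.sum_congr rfl fun v _ => ?_
    rw [← Finset.sum_add_distrib, ← Finset.sum_add_distrib]
    refine Finset.sum_congr rfl fun x _ => ?_
    simp only [append_mem_derangements_iff, Fin.castSucc_ne_last, and_false, not_false_eq_true,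
      and_true, if_true, add_zero, Bool.false_eq_true, if_false, ite_self]
    by_cases h : Even (neg x)
    · simp [h, Nat.even_add_one]
    · simp [h, Nat.even_add_one]
  -- Last absolute value `n + 1`: its sign must be negative, so `x` has an odd number of negative
  -- letters.
  · simp only [flagMaj_append_last, Nat.even_add_one, Bool.false_eq_true, if_false,
      Nat.not_even_iff_odd, and_true, Bool.true_eq_false, and_false, Finset.sum_const_zero,
      ite_self, zero_add, add_zero]

end SignedPerm

/-! ### The identity in the field of rational functions -/

theorem mainTheorem1 (n : ℕ) (hn : 2 ≤ n) :
    algebraMap ℚ[X] (RatFunc ℚ) (dDPoly n) =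
      qEvenFactorial (RatFunc.X : RatFunc ℚ) (n - 1) *
        ∑ k ∈ Finset.range (n - 1),
          ((-1) ^ k * (RatFunc.X : RatFunc ℚ) ^ (2 * Nat.choose k 2)
              / qEvenFactorial (RatFunc.X : RatFunc ℚ) k) *
            ((RatFunc.X : RatFunc ℚ) ^ (2 * k + 1) * qInt (RatFunc.X : RatFunc ℚ) (n - 1 - k)
              + 1 / 2 * (1 - ((1 - (RatFunc.X : RatFunc ℚ)) / (1 + RatFunc.X)) ^ (n - k - 1))) := by
  obtain ⟨m, rfl⟩ : ∃ m, n = m + 1 := ⟨n - 1, by omega⟩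
  have h : ∀ j : ℕ, (RatFunc.X : RatFunc ℚ) ^ (2 * (j + 1)) ≠ 1 := by
    intro j hj
    rw [← RatFunc.algebraMap_X, ← map_pow, ← map_one (algebraMap ℚ[X] (RatFunc ℚ))] at hj
    have h1 := congrArg natDegree (RatFunc.algebraMap_injective ℚ hj)
    rw [natDegree_X_pow, natDegree_one] at h1
    omega
  rw [dDPoly, map_sum]
  simp only [map_pow, RatFunc.algebraMap_X]
  rw [SignedPerm.sum_derangementsD_pow_Dmaj, SignedPerm.derangementSumLastPos_eq h,
    oddDerangementSum_eq h, ← mul_add, ← Finset.sum_add_distrib, Finset.sum_range_succ,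
    Nat.add_sub_cancel]
  -- The terms with `k = m` vanish because `[0]_q = 0` and `1 - r ^ 0 = 0`, which leaves the stated
  -- range.
  have h0 : ∀ a : RatFunc ℚ, a * qInt (RatFunc.X : RatFunc ℚ) (m - m) = 0 := by
    intro a; simp [qInt]
  rw [h0, Nat.sub_self, pow_zero, sub_self, mul_zero, mul_zero, mul_zero, add_zero, add_zero]
  congr 1
  refine Finset.sum_congr rfl fun k _ => ?_
  rw [mul_add, show m + 1 - k - 1 = m - k by omega]
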